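/- **Setting.** Let $\mathcal X,\mathcal Y$ be measurable spaces (for instance $\mathcal X\subseteq\mathbb R^d$, $\mathcal Y=\{-1,+1\}$), and let $D$ be a probability distribution on $\mathcal X\times\{a,b\}\times\mathcal Y$, where the middle coordinate is a sensitive attribute and both groups $g\in\{a,b\}$ have positive probability. Let $D_{|g}$ be the conditional distribution of $(x,y)$ given attribute $g$. Let $\ell:\mathcal Y'\times\mathcal Y\to\{0,1\}$ be a loss and $\mathcal H$ a set of classifiers $h:\mathcal X\to\mathcal Y'$ carrying a $\sigma$-algebra for which $(h,x,y)\mapsto\ell(h(x),y)$ is measurable. For a distribution $P$ on $\mathcal X\times\mathcal Y$ and a probability measure $\rho$ on $\mathcal H$ put $R_P(h)=\mathbb E_{(x,y)\sim P}\,\ell(h(x),y)$, $$b_P^\rho(h)=\mathbb E_{(x,y)\sim P}\big[\mathbb E_{h'\sim\rho}\ell(h'(x),y)\,\big|\,\ell(h(x),y)=0\big],\qquad c_P^\rho(h)=\mathbb E_{(x,y)\sim P}\big[\mathbb E_{h'\sim\rho}\ell(h'(x),y)\,\big|\,\ell(h(x),y)=1\big].$$ Let $\mathrm{kl}(q\|p)=q\ln\frac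 qp+(1-q)\ln\frac{1-q}{1-p}$ for $q,p\in[0,1]$ (with $0\ln 0=0$, and $\mathrm{kl}(q\|p)=\infty$ if $p=0<q$ or $q<1=p$), and $\overline{\mathrm{kl}}(q\|\varepsilon)=\max\{r\in[0,1]:\mathrm{kl}(q\|r)\le\varepsilon\}$, $\underline{\mathrm{kl}}(q\|\varepsilon)=\min\{r\in[0,1]:\mathrm{kl}(q\|r)\le\varepsilon\}$. Let $\pi$ be a (prior) probability measure on $\mathcal H$, fixed in advance. For a sample $T=\{(x_i,y_i)\}_{i=1}^n$, a (posterior) probability measure $\rho$ on $\mathcal H$ and $\eta\in(0,1]$, let $\widehat R_T(G_\rho)=\mathbb E_{h\sim\rho}\frac1n\sum_{i=1}^n\ell(h(x_i),y_i)$ and $$R_T^{\uparrow}(\rho,\pi,\eta)=\overline{\mathrm{kl}}\Big(\widehat R_T(G_\rho)\,\Big\|\,\tfrac1n\big[\mathrm{KL}(\rho\|\pi)+\ln\tfrac{2\sqrt n}{\eta}\big]\Big),\qquad R_T^{\downarrow}(\rho,\pi,\eta)=\underline{\mathrm{kl}}\Big(\widehat R_T(G_\rho)\,\Big\|\,\tfrac1n\big[\mathrm{KL}(\rho\|\pi)+\ln\tfrac{2\sqrt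 n}{\eta}\big]\Big),$$ with the convention $R_T^\uparrow=1$, $R_T^\downarrow=0$ if $n=0$. For a sample $S$ from $D^m$, let $S_{|g}$ be the subsample of the pairs $(x_i,y_i)$ of those examples whose attribute is $g$. For $h\in\mathcal H$, a posterior $\rho$ and a group $g$, let $b_g^\downarrow,b_g^\uparrow,c_g^\downarrow,c_g^\uparrow$ be real numbers (which may depend on $h$, $\rho$ and $S$) with $c_g^\downarrow>b_g^\downarrow$, $c_g^\uparrow>b_g^\uparrow$ and $$b_g^\downarrow\le b_{D_{|g}}^\rho(h)\le b_g^\uparrow,\qquad c_g^\downarrow\le c_{D_{|g}}^\rho(h)\le c_g^\uparrow ,$$ where a condition on a conditional expectation given a null event (which is undefined) is dropped. Put $$\mathfrak R_{S_{|g}}^{\uparrow}(\rho,\pi,\eta,h)=\frac{R_{S_{|g}}^{\uparrow}(\rho,\pi,\eta)-b_g^\downarrow}{c_g^\downarrow-b_g^\downarrow},\qquad \mathfrak R_{S_{|g}}^{\downarrow}(\rho,\pi,\eta,h)=\frac{R_{S_{|g}}^{\downarrow}(\rho,\pi,\eta)-b_g^\uparrow}{c_g^\uparrow-b_g^\uparrow}.$$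 **Theorem.** For every $D$, $\ell$, $\mathcal H$, $\pi$ as above, every $\delta\in(0,1]$ and every $m\ge 0$, with probability at least $1-\delta$ over $S\sim D^m$, the following holds simultaneously for every probability measure $\rho$ on $\mathcal H$, every $h\in\mathcal H$ and all numbers $b_g^\downarrow,b_g^\uparrow,c_g^\downarrow,c_g^\uparrow$ ($g\in\{a,b\}$) as above: $$\big|R_{D_{|a}}(h)-R_{D_{|b}}(h)\big|\le\max\Big\{\mathfrak R_{S_{|a}}^{\uparrow}(\rho,\pi,\tfrac\delta4,h)-\mathfrak R_{S_{|b}}^{\downarrow}(\rho,\pi,\tfrac\delta4,h),\ \mathfrak R_{S_{|b}}^{\uparrow}(\rho,\pi,\tfrac\delta4,h)-\mathfrak R_{S_{|a}}^{\downarrow}(\rho,\pi,\tfrac\delta4,h)\Big\}.$$ -/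

import Mathlib

open MeasureTheory
open scoped ENNReal

namespace FairPACBayes

/-- The binary sensitive attribute `g ∈ {a, b}`. -/
inductive Attr : Type
  | a : Attr
  | b : Attr
  deriving DecidableEq

/-- Every subset of `{a, b}` is measurable. -/
instance : MeasurableSpace Attr := ⊤

noncomputable section

variable {𝒳 𝒴 𝒴' : Type*}

section Risks

variable [MeasurableSpace 𝒳] [MeasurableSpace 𝒴]

/-- The conditional distribution `D_{|g}` of `(x, y)` given that the sensitive attribute is `g`,
for a distribution `D` of triples `(x, g, y)`. -/
def condDist (D : Measure (𝒳 × Attr × 𝒴)) (g : Attr) : Measure (𝒳 × 𝒴) :=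
  (ProbabilityTheory.cond D {z | z.2.1 = g}).map (fun z => (z.1, z.2.2))

/-- True risk `R_P(h)`. -/
def risk (ℓ : 𝒴' → 𝒴 → ℝ) (P : Measure (𝒳 × 𝒴)) (h : 𝒳 → 𝒴') : ℝ :=
  ∫ z, ℓ (h z.1) z.2 ∂P

/-- True fairness risk `|R_{D|a}(h) - R_{D|b}(h)|`. -/
def fairRisk (ℓ : 𝒴' → 𝒴 → ℝ) (D : Measure (𝒳 × Attr × 𝒴)) (h : 𝒳 → 𝒴') : ℝ :=
  |risk ℓ (condDist D Attr.a) h - risk ℓ (condDist D Attr.b) h|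

variable {ℋ : Set (𝒳 → 𝒴')} [MeasurableSpace ℋ]

/-- `𝔼[𝔼_{h' ∼ ρ} ℓ(h'(x), y) | ℓ(h(x), y) = v]` for `(x, y) ∼ P`. -/
def condGibbs (ℓ : 𝒴' → 𝒴 → ℝ) (P : Measure (𝒳 × 𝒴)) (ρ : Measure ℋ) (h : 𝒳 → 𝒴') (v : ℝ) : ℝ :=
  ∫ z, (∫ h' : ℋ, ℓ (h'.1 z.1) z.2 ∂ρ) ∂(ProbabilityTheory.cond P {z | ℓ (h z.1) z.2 = v})

/-- `b_P^ρ(h)`: how `ρ` behaves on the examples on which `h` is correct. -/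
def bTerm (ℓ : 𝒴' → 𝒴 → ℝ) (P : Measure (𝒳 × 𝒴)) (ρ : Measure ℋ) (h : 𝒳 → 𝒴') : ℝ :=
  condGibbs ℓ P ρ h 0

/-- `c_P^ρ(h)`: how `ρ` behaves on the examples on which `h` errs. -/
def cTerm (ℓ : 𝒴' → 𝒴 → ℝ) (P : Measure (𝒳 × 𝒴)) (ρ : Measure ℋ) (h : 𝒳 → 𝒴') : ℝ :=
  condGibbs ℓ P ρ h 1

/-- Numbers proposed as lower and upper bounds on `b_P^ρ(h)` and `c_P^ρ(h)`. -/
structure CondBounds : Type where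
  bLo : ℝ
  bUp : ℝ
  cLo : ℝ
  cUp : ℝ

/-- The numbers in `B` do bound `b_P^ρ(h)` and `c_P^ρ(h)`, with `c↓ > b↓` and `c↑ > b↑`.
A conditional expectation given a null event is undefined, and its bounds are then not
constrained. -/
def CondBounds.Valid (B : CondBounds) (ℓ : 𝒴' → 𝒴 → ℝ) (P : Measure (𝒳 × 𝒴)) (ρ : Measure ℋ)
    (h : 𝒳 → 𝒴') : Prop :=
  (P {z | ℓ (h z.1) z.2 = 0} ≠ 0 → B.bLo ≤ bTerm ℓ P ρ h ∧ bTerm ℓ P ρ h ≤ B.bUp) ∧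
  (P {z | ℓ (h z.1) z.2 = 1} ≠ 0 → B.cLo ≤ cTerm ℓ P ρ h ∧ cTerm ℓ P ρ h ≤ B.cUp) ∧
  B.bLo < B.cLo ∧ B.bUp < B.cUp

end Risks

/-- `kl(q‖p) = q ln (q/p) + (1-q) ln ((1-q)/(1-p))` for `q, p ∈ [0,1]` (where it is nonnegative),
with the usual conventions `0 ln 0 = 0`, and value `∞` when `p = 0 < q` or `q < 1 = p`. -/
def binKl (q p : ℝ) : ℝ≥0∞ :=
  if (p = 0 ∧ q ≠ 0) ∨ (p = 1 ∧ q ≠ 1) then ⊤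
  else ENNReal.ofReal (q * Real.log (q / p) + (1 - q) * Real.log ((1 - q) / (1 - p)))

/-- The largest `r ∈ [0,1]` with `kl(q‖r) ≤ ε`. -/
def klUpper (q : ℝ) (ε : ℝ≥0∞) : ℝ :=
  sSup {r : ℝ | r ∈ Set.Icc (0 : ℝ) 1 ∧ binKl q r ≤ ε}

/-- The smallest `r ∈ [0,1]` with `kl(q‖r) ≤ ε`. -/
def klLower (q : ℝ) (ε : ℝ≥0∞) : ℝ :=
  sInf {r : ℝ | r ∈ Set.Icc (0 : ℝ) 1 ∧ binKl q r ≤ ε}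

section Empirical

variable {ι : Type*} [Fintype ι]

/-- Empirical risk of `h` on a sample `T` indexed by the finite type `ι`. -/
def empRisk (ℓ : 𝒴' → 𝒴 → ℝ) (T : ι → 𝒳 × 𝒴) (h : 𝒳 → 𝒴') : ℝ :=
  (∑ i, ℓ (h (T i).1) (T i).2) / Fintype.card ι

variable {ℋ : Set (𝒳 → 𝒴')} [MeasurableSpace ℋ]

/-- Empirical Gibbs risk of `ρ` on the sample `T`. -/
def empGibbs (ℓ : 𝒴' → 𝒴 → ℝ) (T : ι → 𝒳 × 𝒴) (ρ : Measure ℋ) : ℝ :=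
  ∫ h : ℋ, empRisk ℓ T h.1 ∂ρ

/-- The complexity term `(KL(ρ‖π) + ln (2√n / δ)) / n` for a sample of size `n`; for `n = 0`
(no data) it is `∞`, which makes the risk bounds below the trivial ones, `1` and `0`. -/
def complexity (n : ℕ) (ρ π : Measure ℋ) (δ : ℝ) : ℝ≥0∞ :=
  if n = 0 then ⊤
  else (InformationTheory.klDiv ρ π + ENNReal.ofReal (Real.log (2 * Real.sqrt n / δ))) / n

/-- Seeger-Maurer upper bound on the Gibbs risk, computed on the sample `T`. -/
def gibbsUpper (ℓ : 𝒴' → 𝒴 → ℝ) (T : ι → 𝒳 × 𝒴) (ρ π : Measure ℋ) (δ : ℝ) : ℝ :=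
  klUpper (empGibbs ℓ T ρ) (complexity (Fintype.card ι) ρ π δ)

/-- Seeger-Maurer lower bound on the Gibbs risk, computed on the sample `T`. -/
def gibbsLower (ℓ : 𝒴' → 𝒴 → ℝ) (T : ι → 𝒳 × 𝒴) (ρ π : Measure ℋ) (δ : ℝ) : ℝ :=
  klLower (empGibbs ℓ T ρ) (complexity (Fintype.card ι) ρ π δ)

/-- Upper risk bound for a deterministic classifier `h`; `B` holds the bounds on
`b` and `c` at `(h, ρ)`. -/
def detUpper (ℓ : 𝒴' → 𝒴 → ℝ) (T : ι → 𝒳 × 𝒴) (ρ π : Measure ℋ) (δ : ℝ) (B : CondBounds) : ℝ :=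
  (gibbsUpper ℓ T ρ π δ - B.bLo) / (B.cLo - B.bLo)

/-- Lower risk bound for a deterministic classifier `h`; `B` holds the bounds on
`b` and `c` at `(h, ρ)`. -/
def detLower (ℓ : 𝒴' → 𝒴 → ℝ) (T : ι → 𝒳 × 𝒴) (ρ π : Measure ℋ) (δ : ℝ) (B : CondBounds) : ℝ :=
  (gibbsLower ℓ T ρ π δ - B.bUp) / (B.cUp - B.bUp)

end Empirical

/-- The part `S_{|g}` of the sample `S` whose sensitive attribute equals `g`. -/
def subsample {m : ℕ} (S : Fin m → 𝒳 × Attr × 𝒴) (g : Attr) :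
    {i : Fin m // (S i).2.1 = g} → 𝒳 × 𝒴 :=
  fun i => ((S i.1).1, (S i.1).2.2)

end

end FairPACBayes

open FairPACBayes

namespace FairPACBayes

/-! Two facts combine. For a fixed classifier `h` of risk `R`, the Gibbs risk equals `(1 - R) * b +
R * c`, so bounds on the Gibbs risk, `b` and `c` can be solved for `R` (`risk_mem_of_valid`). The
Gibbs risks of the two groups are controlled by a PAC-Bayes-kl bound uniform in `ρ`.

For that bound, a classifier of risk `u` with `k` errors among `n = k + j` examples satisfies `exp
(n * kl(k/n‖u)) = bernoulliMax k j / (u ^ k * (1 - u) ^ j)` in the nondegenerate case. The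
expectation of this ratio is at most a binomial sum, bounded by `4 * √n` via Stirling
(`sum_choose_mul_bernoulliMax_le`). A group's sample size is random, so the ratio is divided by `√n`
before taking expectations (`lintegral_scaledRatio_le`): a single Markov event then serves all
sizes. Averaging over the prior and changing measure (`binKl_integral_le`) gives every posterior at
once.

The constant 4 suffices because each group's event yields both the upper and the lower bound. Only
two events are needed, each of failure probability `δ / 2`, while the bounds are stated at level `δ
/ 4`. -/

/-! ### Stirling estimates and the binomial sum of maximal likelihoods. -/

open Finset in
-- Telescoping: `1 / √(n + 1) ≤ 2 * (√(n + 1) - √n)`. The term `k = 0` is zero, since division by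
-- zero gives zero.
lemma sum_range_inv_sqrt_le (n : ℕ) : ∑ k ∈ range (n + 1), 1 / √(k : ℝ) ≤ 2 * √n := by
  induction n with
  | zero => simp
  | succ n ih =>
    rw [sum_range_succ]
    have h0 : 0 ≤ √(n : ℝ) := Real.sqrt_nonneg _
    have h1 : 0 < √((n + 1 : ℕ) : ℝ) := Real.sqrt_pos.2 (by positivity)
    have h2 : √(n : ℝ) ^ 2 = n := Real.sq_sqrt (by positivity)
    have h3 : √((n + 1 : ℕ) : ℝ) ^ 2 = n + 1 := by rw [Real.sq_sqrt (by positivity)]; push_cast; ring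
    have h4 : 1 / √((n + 1 : ℕ) : ℝ) ≤ 2 * √((n + 1 : ℕ) : ℝ) - 2 * √(n : ℝ) := by
      rw [div_le_iff₀ h1]
      nlinarith [sq_nonneg (√((n + 1 : ℕ) : ℝ) - √(n : ℝ))]
    linarith

/-- Stirling's upper bound on the factorial. -/
lemma factorial_le_stirling {n : ℕ} (hn : n ≠ 0) :
    (n.factorial : ℝ) ≤ Real.exp 1 * √n * (n / Real.exp 1) ^ n := by
  obtain ⟨k, rfl⟩ := Nat.exists_eq_succ_of_ne_zero hn
  have h : Stirling.stirlingSeq (k + 1) ≤ Stirling.stirlingSeq 1 :=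
    Stirling.stirlingSeq'_antitone (Nat.zero_le k)
  rw [Stirling.stirlingSeq_one, Stirling.stirlingSeq, div_le_iff₀ (by positivity)] at h
  refine h.trans (le_of_eq ?_)
  rw [Real.sqrt_mul (by norm_num)]
  field_simp

/-- The largest value of `s ^ k * (1 - s) ^ j`, attained at `s = k / (k + j)`. -/
noncomputable def bernoulliMax (k j : ℕ) : ℝ :=
  ((k : ℝ) / (k + j)) ^ k * ((j : ℝ) / (k + j)) ^ j

lemma bernoulliMax_pos (k j : ℕ) : 0 < bernoulliMax k j := by
  have key (a b : ℕ) : 0 < ((a : ℝ) / (a + b)) ^ a := by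
    rcases Nat.eq_zero_or_pos a with rfl | h
    · simp
    · have : (0 : ℝ) < a := by exact_mod_cast h
      positivity
  have h := key j k
  rw [add_comm (j : ℝ)] at h
  exact mul_pos (key k j) h

lemma bernoulliMax_le_one (k j : ℕ) : bernoulliMax k j ≤ 1 := by
  unfold bernoulliMax
  refine mul_le_one₀ (pow_le_one₀ (by positivity) ?_) (by positivity)
    (pow_le_one₀ (by positivity) ?_)
  · exact div_le_one_of_le₀ (by simp) (by positivity)
  · exact div_le_one_of_le₀ (by simp) (by positivity)

lemma pow_mul_pow_le_bernoulliMax (k j : ℕ) {x y : ℝ} (hx : 0 ≤ x) (hy : 0 ≤ y) :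
    x ^ k * y ^ j ≤ bernoulliMax k j * (x + y) ^ (k + j) := by
  rcases Nat.eq_zero_or_pos k with rfl | hk
  · rcases Nat.eq_zero_or_pos j with rfl | hj
    · simp [bernoulliMax]
    · have : (j : ℝ) ≠ 0 := by positivity
      simpa [bernoulliMax, this] using pow_le_pow_left₀ hy (by linarith : y ≤ x + y) j
  rcases Nat.eq_zero_or_pos j with rfl | hj
  · have : (k : ℝ) ≠ 0 := by positivity
    simpa [bernoulliMax, this] using pow_le_pow_left₀ hx (by linarith : x ≤ x + y) k
  have hk' : (0 : ℝ) < k := by exact_mod_cast hk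
  have hj' : (0 : ℝ) < j := by exact_mod_cast hj
  have hn : (0 : ℝ) < k + j := by positivity
  -- The points are scaled so that their weighted arithmetic mean is exactly `x + y`.
  have h := Real.geom_mean_le_arith_mean2_weighted (w₁ := k / (k + j)) (w₂ := j / (k + j))
    (p₁ := x * (k + j) / k) (p₂ := y * (k + j) / j) (by positivity) (by positivity)
    (by positivity) (by positivity) (by field_simp)
  have h' := pow_le_pow_left₀ (by positivity) h (k + j)
  rw [mul_pow, ← Real.rpow_mul_natCast (by positivity), ← Real.rpow_mul_natCast (by positivity)] at h'
  have e1 : (k : ℝ) / (k + j) * ((k + j : ℕ) : ℝ) = k := by push_cast; field_simp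
  have e2 : (j : ℝ) / (k + j) * ((k + j : ℕ) : ℝ) = j := by push_cast; field_simp
  have e3 : (k : ℝ) / (k + j) * (x * (k + j) / k) + (j : ℝ) / (k + j) * (y * (k + j) / j) = x + y := by
    field_simp
  rw [e1, e2, e3, Real.rpow_natCast, Real.rpow_natCast] at h'
  have e4 : x ^ k * y ^ j = bernoulliMax k j * ((x * (k + j) / k) ^ k * (y * (k + j) / j) ^ j) := by
    rw [bernoulliMax, mul_mul_mul_comm, ← mul_pow, ← mul_pow]
    congr 2 <;> field_simp
  rw [e4]
  exact mul_le_mul_of_nonneg_left h' (bernoulliMax_pos k j).le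

/-- Stirling from both sides gives at most `e * √(k + j) / (2π * √k * √j)`. The bounds `e ≤ π` and
`√(k + j) ≤ √k + √j` then separate `k` from `j`, which makes the sum over `k` elementary. -/
lemma choose_mul_bernoulliMax_le {k j : ℕ} (hk : k ≠ 0) (hj : j ≠ 0) :
    ((k + j).choose k : ℝ) * bernoulliMax k j ≤ (1 / √k + 1 / √j) / 2 := by
  have hk' : (0 : ℝ) < k := by positivity
  have hj' : (0 : ℝ) < j := by positivity
  have h1 := Stirling.le_factorial_stirling k
  have h2 := Stirling.le_factorial_stirling j
  have h3 := factorial_le_stirling (n := k + j) (by omega)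
  have hc : ((k + j).choose k : ℝ) * (k.factorial * j.factorial) = (k + j).factorial := by
    rw [← mul_assoc, Nat.choose_symm_add]
    exact_mod_cast Nat.add_choose_mul_factorial_mul_factorial k j
  have hsk : 0 < √(k : ℝ) := Real.sqrt_pos.2 hk'
  have hsj : 0 < √(j : ℝ) := Real.sqrt_pos.2 hj'
  have hs : √((k + j : ℕ) : ℝ) ≤ √k + √j := by
    push_cast
    refine Real.sqrt_le_iff.2 ⟨by positivity, ?_⟩
    nlinarith [Real.sq_sqrt hk'.le, Real.sq_sqrt hj'.le]
  set c : ℝ := ((k + j).choose k : ℝ) with hcdef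
  have hc0 : 0 ≤ c := by positivity
  have h4 : c * ((√(2 * Real.pi * k) * (k / Real.exp 1) ^ k) *
      (√(2 * Real.pi * j) * (j / Real.exp 1) ^ j)) ≤
      Real.exp 1 * √((k + j : ℕ) : ℝ) * (((k + j : ℕ) : ℝ) / Real.exp 1) ^ (k + j) := by
    refine le_trans ?_ (hc.le.trans h3)
    gcongr
  have hp : √(2 * Real.pi * k) * √(2 * Real.pi * j) = 2 * Real.pi * (√k * √j) := by
    rw [Real.sqrt_mul (by positivity), Real.sqrt_mul (by positivity) (j : ℝ), mul_mul_mul_comm,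
      Real.mul_self_sqrt (by positivity)]
  have hb : (k / Real.exp 1 : ℝ) ^ k * (j / Real.exp 1 : ℝ) ^ j =
      bernoulliMax k j * (((k + j : ℕ) : ℝ) / Real.exp 1) ^ (k + j) := by
    rw [bernoulliMax, pow_add, mul_mul_mul_comm, ← mul_pow, ← mul_pow]
    push_cast
    congr 2 <;> field_simp
  have hN : 0 < (((k + j : ℕ) : ℝ) / Real.exp 1) ^ (k + j) := by
    have : (0 : ℝ) < ((k + j : ℕ) : ℝ) := by exact_mod_cast (by omega)
    positivity
  rw [mul_mul_mul_comm, hp, hb] at h4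
  have h5 : c * bernoulliMax k j * (2 * Real.pi * (√k * √j)) ≤ Real.exp 1 * √((k + j : ℕ) : ℝ) := by
    refine le_of_mul_le_mul_right (le_trans (le_of_eq ?_) h4) hN
    ring
  have he : Real.exp 1 ≤ Real.pi := by
    linarith [Real.exp_one_lt_d9, Real.pi_gt_three]
  have h6 : c * bernoulliMax k j * (2 * Real.pi * (√k * √j)) ≤ Real.pi * (√k + √j) :=
    h5.trans (mul_le_mul he hs (by positivity) (by positivity))
  have e : (1 / √(k : ℝ) + 1 / √j) / 2 = Real.pi * (√k + √j) / (2 * Real.pi * (√k * √j)) := by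
    field_simp
    ring
  rw [e, le_div_iff₀ (by positivity)]
  exact h6

open Finset in
-- The two endpoint terms contribute at most `2 ≤ 2 * √n`; the interior terms, after reflecting `k ↦
-- n - k`, contribute at most `∑ 1 / √k ≤ 2 * √n`.
lemma sum_choose_mul_bernoulliMax_le {n : ℕ} (hn : n ≠ 0) :
    ∑ k ∈ range (n + 1), (n.choose k : ℝ) * bernoulliMax k (n - k) ≤ 4 * √n := by
  have hterm : ∀ k ∈ range (n + 1), (n.choose k : ℝ) * bernoulliMax k (n - k) ≤
      ((if k = 0 then 1 else 0) + (if k = n then 1 else 0)) +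
        (1 / √(k : ℝ) / 2 + 1 / √((n - k : ℕ) : ℝ) / 2) := by
    intro k hk
    have hkn : k ≤ n := by simpa [Nat.lt_succ_iff] using hk
    have hp : 0 ≤ 1 / √(k : ℝ) / 2 + 1 / √((n - k : ℕ) : ℝ) / 2 := by positivity
    rcases eq_or_ne k 0 with rfl | hk0
    · have := bernoulliMax_le_one 0 (n - 0)
      simp only [Nat.choose_zero_right, if_true, Nat.cast_one, one_mul]
      have : (0 : ℝ) ≤ if 0 = n then 1 else 0 := by positivity
      linarith
    rcases eq_or_ne k n with rfl | hkn'
    · have := bernoulliMax_le_one k (k - k)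
      simp only [Nat.choose_self, if_true, Nat.cast_one, one_mul, hk0, if_false]
      linarith
    · have h := choose_mul_bernoulliMax_le hk0 (j := n - k) (by omega)
      rw [Nat.add_sub_cancel' hkn] at h
      simp only [hk0, hkn', if_false]
      linarith
  refine (sum_le_sum hterm).trans ?_
  have hrefl : ∑ k ∈ range (n + 1), 1 / √((n - k : ℕ) : ℝ) = ∑ k ∈ range (n + 1), 1 / √(k : ℝ) := by
    have := sum_range_reflect (fun k : ℕ => 1 / √(k : ℝ)) (n + 1)
    simpa using this
  rw [sum_add_distrib, sum_add_distrib, sum_add_distrib, ← sum_div, ← sum_div, hrefl]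
  have h1 : 1 ≤ √(n : ℝ) := by
    rw [Real.one_le_sqrt]; exact_mod_cast Nat.one_le_iff_ne_zero.2 hn
  have := sum_range_inv_sqrt_le n
  simp only [sum_ite_eq', mem_range, Nat.lt_add_one, Nat.succ_pos, if_true]
  linarith

/-! ### Duality for the binary relative entropy and change of measure. -/

/-- Legendre dual description of the binary relative entropy. -/
lemma binKl_le_of_forall {q p ε : ℝ} (hq : q ∈ Set.Icc (0 : ℝ) 1) (hp : p ∈ Set.Icc (0 : ℝ) 1)
    (h : ∀ t : ℝ, t * q - Real.log ((1 - p) + p * Real.exp t) ≤ ε) :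
    binKl q p ≤ ENNReal.ofReal ε := by
  obtain ⟨hq0, hq1⟩ := hq
  obtain ⟨hp0, hp1⟩ := hp
  have hε : 0 ≤ ε := by simpa using h 0
  rcases hp0.eq_or_lt with rfl | hp0
  · have hq : q = 0 := by
      by_contra hne
      -- At `p = 0` the logarithm vanishes, so this `t` makes the dual value `ε + 1`.
      have := h ((ε + 1) / q)
      rw [div_mul_cancel₀ _ hne] at this
      simp at this
      linarith
    simp [binKl, hq]
  rcases hp1.eq_or_lt with rfl | hp1
  · have hq : q = 1 := by
      by_contra hne
      have hlt : 0 < 1 - q := sub_pos.2 (lt_of_le_of_ne hq1 hne)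
      have := h (-((ε + 1) / (1 - q)))
      simp only [sub_self, zero_add, one_mul, Real.log_exp] at this
      have e : -((ε + 1) / (1 - q)) * q - -((ε + 1) / (1 - q)) = ε + 1 := by
        field_simp
        ring
      linarith
    simp [binKl, hq]
  rw [binKl, if_neg (by rintro (h | h) <;> linarith [h.1])]
  apply ENNReal.ofReal_le_ofReal
  have hp1' : 0 < 1 - p := by linarith
  rcases hq0.eq_or_lt with rfl | hq0
  -- For `q = 0`, and likewise for `q = 1` below, the supremum is only approached as `t` tends to
  -- infinity in one direction.
  · have hlim : Filter.Tendsto (fun t : ℝ => -Real.log ((1 - p) + p * Real.exp t)) Filter.atBot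
        (nhds (-Real.log ((1 - p) + p * 0))) :=
      ((tendsto_const_nhds.add (Real.tendsto_exp_atBot.const_mul p)).log (by simpa using hp1'.ne')).neg
    have := le_of_tendsto' hlim fun t => by simpa using h t
    simpa [Real.log_div, hp1'.ne'] using this
  rcases hq1.eq_or_lt with rfl | hq1
  · have hlim : Filter.Tendsto (fun t : ℝ => -Real.log ((1 - p) * Real.exp (-t) + p)) Filter.atTop
        (nhds (-Real.log ((1 - p) * 0 + p))) :=
      (((Real.tendsto_exp_neg_atTop_nhds_zero.const_mul (1 - p)).add tendsto_const_nhds).log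
        (by simpa using hp0.ne')).neg
    have := le_of_tendsto' hlim (b := ε) fun t => by
      refine le_trans (le_of_eq ?_) (h t)
      have e : (1 - p) + p * Real.exp t = Real.exp t * ((1 - p) * Real.exp (-t) + p) := by
        rw [Real.exp_neg]; field_simp
      rw [e, Real.log_mul (by positivity) (by positivity), Real.log_exp]
      ring
    simpa [Real.log_div, hp0.ne'] using this
  have hq1' : 0 < 1 - q := by linarith
  -- The maximiser of the dual objective: the difference of the log-odds of `q` and `p`.
  refine le_trans (le_of_eq ?_) (h (Real.log (q / p) - Real.log ((1 - q) / (1 - p))))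
  have e : (1 - p) + p * Real.exp (Real.log (q / p) - Real.log ((1 - q) / (1 - p))) =
      ((1 - q) / (1 - p))⁻¹ := by
    rw [Real.exp_sub, Real.exp_log (by positivity), Real.exp_log (by positivity)]
    field_simp
    ring
  rw [e, Real.log_inv]
  ring

section ChangeOfMeasure

variable {Ω : Type*} [MeasurableSpace Ω]

/-- The Donsker-Varadhan inequality for a bounded function. -/
lemma integral_le_klDiv_add_log {ρ π : Measure Ω} [IsProbabilityMeasure ρ] [IsProbabilityMeasure π]
    (hkl : InformationTheory.klDiv ρ π ≠ ⊤) {f : Ω → ℝ} (hf : Measurable f) {C : ℝ}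
    (hC : ∀ x, |f x| ≤ C) :
    ∫ x, f x ∂ρ ≤ (InformationTheory.klDiv ρ π).toReal + Real.log (∫ x, Real.exp (f x) ∂π) := by
  obtain ⟨hac, hint⟩ := InformationTheory.klDiv_ne_top_iff.1 hkl
  have hfρ : Integrable f ρ := Integrable.of_bound hf.aestronglyMeasurable C (.of_forall hC)
  have hfπ : Integrable (fun x => Real.exp (f x)) π :=
    Integrable.of_bound hf.exp.aestronglyMeasurable (Real.exp C) (.of_forall fun x => by
      simpa using (abs_le.1 (hC x)).2)
  have := isProbabilityMeasure_tilted hfπ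
  have h := integral_llr_tilted_right hac hfρ hfπ hint
  -- Donsker-Varadhan is nonnegativity of the relative entropy of `ρ` with respect to `π` tilted by
  -- `f`.
  have h0 := InformationTheory.integral_llr_add_sub_measure_univ_nonneg
    (hac.trans (absolutelyContinuous_tilted hfπ)) (integrable_llr_tilted_right hac hfρ hint hfπ)
  rw [InformationTheory.toReal_klDiv_of_measure_eq hac (by simp)]
  simp only [probReal_univ, add_sub_cancel_right] at h0
  linarith

/-- PAC-Bayesian change of measure: a bound on the likelihood ratio averaged over the prior bounds
the binary relative entropy of the two posterior averages. -/
lemma binKl_integral_le {ρ π : Measure Ω} [IsProbabilityMeasure ρ] [IsProbabilityMeasure π]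
    {n : ℕ} (hn : n ≠ 0) {k j : Ω → ℕ} (hk : Measurable k) (hkj : ∀ x, k x + j x = n)
    {u v : Ω → ℝ≥0∞} (hu : Measurable u) (huv : ∀ x, u x + v x = 1) {M : ℝ} (hM : 1 ≤ M)
    (hL : ∫⁻ x, ENNReal.ofReal (bernoulliMax (k x) (j x)) / (u x ^ k x * v x ^ j x) ∂π ≤
      ENNReal.ofReal M) :
    binKl (∫ x, (k x : ℝ) / n ∂ρ) (∫ x, (u x).toReal ∂ρ) ≤
      (InformationTheory.klDiv ρ π + ENNReal.ofReal (Real.log M)) / n := by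
  have hn' : (0 : ℝ) < n := by positivity
  by_cases hkl : InformationTheory.klDiv ρ π = ⊤
  · simp [hkl, ENNReal.top_div_of_ne_top]
  have hu1 x : u x ≤ 1 := huv x ▸ le_self_add
  have hv1 x : v x ≤ 1 := huv x ▸ le_add_self
  have hut x : u x ≠ ⊤ := ((hu1 x).trans_lt ENNReal.one_lt_top).ne
  have hvt x : v x ≠ ⊤ := ((hv1 x).trans_lt ENNReal.one_lt_top).ne
  have hu1' x : (u x).toReal ≤ 1 := ENNReal.toReal_le_of_le_ofReal zero_le_one (by simpa using hu1 x)
  have hv' x : (v x).toReal = 1 - (u x).toReal := by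
    have := congrArg ENNReal.toReal (huv x)
    rw [ENNReal.toReal_add (hut x) (hvt x), ENNReal.toReal_one] at this
    linarith
  have hkn x : (k x : ℝ) ≤ n := by exact_mod_cast (hkj x) ▸ Nat.le_add_right _ _
  have hkm : Measurable fun x => (k x : ℝ) := measurable_from_top.comp hk
  have hkint : Integrable (fun x => (k x : ℝ) / n) ρ :=
    Integrable.of_bound (hkm.div_const _).aestronglyMeasurable 1 (.of_forall fun x => by
      rw [Real.norm_of_nonneg (by positivity)]
      exact div_le_one_of_le₀ (hkn x) hn'.le)
  have huint : Integrable (fun x => (u x).toReal) ρ :=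
    Integrable.of_bound hu.ennreal_toReal.aestronglyMeasurable 1 (.of_forall fun x => by
      rw [Real.norm_of_nonneg (by positivity)]
      exact hu1' x)
  have heq : (InformationTheory.klDiv ρ π + ENNReal.ofReal (Real.log M)) / n = ENNReal.ofReal
      (((InformationTheory.klDiv ρ π).toReal + Real.log M) / n) := by
    rw [ENNReal.ofReal_div_of_pos hn', ENNReal.ofReal_add ENNReal.toReal_nonneg (Real.log_nonneg hM),
      ENNReal.ofReal_toReal hkl, ENNReal.ofReal_natCast]
  have hq : ∫ x, (k x : ℝ) / n ∂ρ ∈ Set.Icc (0 : ℝ) 1 := by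
    refine ⟨integral_nonneg fun x => by positivity, ?_⟩
    calc ∫ x, (k x : ℝ) / n ∂ρ ≤ ∫ _, (1 : ℝ) ∂ρ :=
          integral_mono hkint (integrable_const _) fun x => div_le_one_of_le₀ (hkn x) hn'.le
      _ = 1 := by simp
  have hp : ∫ x, (u x).toReal ∂ρ ∈ Set.Icc (0 : ℝ) 1 := by
    refine ⟨integral_nonneg fun x => by positivity, ?_⟩
    calc ∫ x, (u x).toReal ∂ρ ≤ ∫ _, (1 : ℝ) ∂ρ := integral_mono huint (integrable_const _) hu1'
      _ = 1 := by simp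
  rw [heq]
  -- Fixing the dual variable `t` replaces joint convexity of kl by concavity of the logarithm, and
  -- the possibly infinite likelihood ratio by a bounded function.
  refine binKl_le_of_forall hq hp fun t => ?_
  set p := ∫ x, (u x).toReal ∂ρ with hpdef
  have mixture_bounds {s : ℝ} (h0 : 0 ≤ s) (h1 : s ≤ 1) :
      Real.exp (-|t|) ≤ (1 - s) + s * Real.exp t ∧ (1 - s) + s * Real.exp t ≤ Real.exp |t| := by
    have a1 : Real.exp (-|t|) ≤ Real.exp t := Real.exp_le_exp.2 (neg_abs_le t)
    have a2 : Real.exp t ≤ Real.exp |t| := Real.exp_le_exp.2 (le_abs_self t)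
    have a3 : Real.exp (-|t|) ≤ 1 := Real.exp_le_one_iff.2 (by simp)
    have a4 : 1 ≤ Real.exp |t| := Real.one_le_exp (abs_nonneg t)
    constructor <;> nlinarith
  have mixture_pos {s : ℝ} (h0 : 0 ≤ s) (h1 : s ≤ 1) : 0 < (1 - s) + s * Real.exp t :=
    (Real.exp_pos _).trans_le (mixture_bounds h0 h1).1
  set w : Ω → ℝ := fun x => (1 - (u x).toReal) + (u x).toReal * Real.exp t with hw
  have hwpos x : 0 < w x := mixture_pos (by positivity) (hu1' x)
  have hwm : Measurable w := by fun_prop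
  have hlog x : |Real.log (w x)| ≤ |t| := by
    obtain ⟨h1, h2⟩ := mixture_bounds (s := (u x).toReal) (by positivity) (hu1' x)
    rw [abs_le]
    exact ⟨(Real.le_log_iff_exp_le (hwpos x)).2 h1, (Real.log_le_iff_le_exp (hwpos x)).2 h2⟩
  have hlogint : Integrable (fun x => Real.log (w x)) ρ :=
    Integrable.of_bound hwm.log.aestronglyMeasurable |t| (.of_forall hlog)
  set f : Ω → ℝ := fun x => n * (t * ((k x : ℝ) / n) - Real.log (w x)) with hf
  have hfm : Measurable f := by fun_prop
  have hfb x : |f x| ≤ n * (|t| + |t|) := by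
    rw [hf, abs_mul, Nat.abs_cast]
    refine mul_le_mul_of_nonneg_left ((abs_sub _ _).trans (add_le_add ?_ (hlog x))) hn'.le
    rw [abs_mul, abs_of_nonneg (by positivity : 0 ≤ (k x : ℝ) / n)]
    exact mul_le_of_le_one_right (abs_nonneg t) (div_le_one_of_le₀ (hkn x) hn'.le)
  have hexp x : ENNReal.ofReal (Real.exp (f x)) ≤
      ENNReal.ofReal (bernoulliMax (k x) (j x)) / (u x ^ k x * v x ^ j x) := by
    have hb := bernoulliMax_pos (k x) (j x)
    rw [ENNReal.le_div_iff_mul_le (.inr (by simpa using hb)) (.inr ENNReal.ofReal_ne_top)]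
    have hwn : Real.exp (f x) = Real.exp t ^ k x / w x ^ n := by
      have e : f x = k x * t - n * Real.log (w x) := by
        simp only [hf]; field_simp
      rw [e, Real.exp_sub, Real.exp_nat_mul, Real.exp_nat_mul, Real.exp_log (hwpos x)]
    have e : u x ^ k x * v x ^ j x =
        ENNReal.ofReal ((u x).toReal ^ k x * (v x).toReal ^ j x) := by
      rw [ENNReal.ofReal_mul (by positivity), ENNReal.ofReal_pow (by positivity),
        ENNReal.ofReal_pow (by positivity), ENNReal.ofReal_toReal (hut x),
        ENNReal.ofReal_toReal (hvt x)]
    rw [e, ← ENNReal.ofReal_mul (by positivity)]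
    apply ENNReal.ofReal_le_ofReal
    -- Maximality of `bernoulliMax` at the tilted weights `u * exp t` and `v`, whose sum is `w`.
    have h := pow_mul_pow_le_bernoulliMax (k x) (j x) (x := (u x).toReal * Real.exp t)
      (y := (v x).toReal) (by positivity) (by positivity)
    have e2 : (u x).toReal * Real.exp t + (v x).toReal = w x := by rw [hv', hw]; ring
    rw [e2, hkj] at h
    have hwnpos : 0 < w x ^ n := pow_pos (hwpos x) n
    rw [hwn, div_mul_eq_mul_div, div_le_iff₀ hwnpos]
    refine le_trans (le_of_eq ?_) h
    rw [mul_pow]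
    ring
  have hfπ : Integrable (fun x => Real.exp (f x)) π :=
    Integrable.of_bound hfm.exp.aestronglyMeasurable (Real.exp (n * (|t| + |t|)))
      (.of_forall fun x => by simpa using (abs_le.1 (hfb x)).2)
  have hE : ∫ x, Real.exp (f x) ∂π ≤ M := by
    rw [← ENNReal.ofReal_le_ofReal_iff (by linarith),
      ofReal_integral_eq_lintegral_ofReal hfπ (.of_forall fun x => (Real.exp_pos _).le)]
    exact (lintegral_mono hexp).trans hL
  have hEpos : 0 < ∫ x, Real.exp (f x) ∂π := integral_exp_pos hfπ
  have hdv := integral_le_klDiv_add_log hkl hfm hfb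
  have hlogE := Real.log_le_log hEpos hE
  have hfi : ∫ x, f x ∂ρ = n * (t * ∫ x, (k x : ℝ) / n ∂ρ) - n * ∫ x, Real.log (w x) ∂ρ := by
    simp only [hf]
    rw [integral_const_mul, integral_sub (hkint.const_mul t) hlogint, integral_const_mul, mul_sub]
  have hx0 := mixture_pos hp.1 hp.2
  have hjensen : ∫ x, Real.log (w x) ∂ρ ≤ Real.log ((1 - p) + p * Real.exp t) := by
    set x₀ := (1 - p) + p * Real.exp t with hx₀
    have hsub : Integrable (fun x => 1 - (u x).toReal) ρ := (integrable_const _).sub huint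
    have hwint : Integrable w ρ := hsub.add (huint.mul_const _)
    have hwi : ∫ x, w x ∂ρ = x₀ := by
      simp only [hw]
      rw [integral_add hsub (huint.mul_const _),
        integral_sub (integrable_const _) huint, integral_mul_const]
      simp [hx₀, hpdef]
    -- Jensen through the tangent line of `log` at the mean `x₀`.
    calc ∫ x, Real.log (w x) ∂ρ ≤ ∫ x, (w x / x₀ + (Real.log x₀ - 1)) ∂ρ := by
          refine integral_mono hlogint ((hwint.div_const _).add (integrable_const _)) fun x => ?_
          have := Real.log_le_sub_one_of_pos (div_pos (hwpos x) hx0)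
          rw [Real.log_div (hwpos x).ne' hx0.ne'] at this
          simp only
          linarith
      _ = Real.log x₀ := by
          rw [integral_add (hwint.div_const _) (integrable_const _), integral_div, hwi,
            div_self hx0.ne']
          simp
  rw [le_div_iff₀ hn']
  have := mul_le_mul_of_nonneg_left hjensen hn'.le
  linarith

end ChangeOfMeasure

/-! ### Expected likelihood ratio of an i.i.d. sample. -/

/-- The ratio of the maximal Bernoulli likelihood of `k` errors in `k + j` examples to the
likelihood `u ^ k * v ^ j`, normalised by `√(k + j)`; it is `0` when there are no examples. -/
noncomputable def scaledRatio (k j : ℕ) (u v : ℝ≥0∞) : ℝ≥0∞ :=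
  if k + j = 0 then 0 else ENNReal.ofReal (bernoulliMax k j / √((k + j : ℕ) : ℝ)) / (u ^ k * v ^ j)

open Finset in
-- Grouping subsets by size gives the binomial sum; dividing by `√#A` makes the bound independent of
-- `A`.
lemma sum_powerset_bernoulliMax_div_le {ι : Type*} (A : Finset ι) :
    ∑ K ∈ A.powerset, (if #A = 0 then 0 else
      ENNReal.ofReal (bernoulliMax #K (#A - #K) / √(#A : ℝ))) ≤ 4 := by
  rcases eq_or_ne #A 0 with hA | hA
  · simp [hA]
  have hs : 0 < √(#A : ℝ) := Real.sqrt_pos.2 (by positivity)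
  simp only [hA, if_false]
  rw [← ENNReal.ofReal_sum_of_nonneg fun K _ =>
      div_nonneg (bernoulliMax_pos _ _).le (Real.sqrt_nonneg _),
    sum_powerset_apply_card (fun k => bernoulliMax k (#A - k) / √(#A : ℝ))]
  refine (ENNReal.ofReal_le_ofReal (q := 4) ?_).trans (by simp)
  have h := sum_choose_mul_bernoulliMax_le hA
  simp only [nsmul_eq_mul, ← mul_div_assoc]
  rw [← sum_div, div_le_iff₀ hs]
  exact h

open Finset in
lemma prod_ite_ite_mem {ι : Type*} [Fintype ι] [DecidableEq ι] {K A : Finset ι} (hK : K ⊆ A)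
    (a b c : ℝ≥0∞) :
    ∏ i, (if i ∈ K then a else if i ∈ A then b else c) =
      a ^ #K * b ^ (#A - #K) * c ^ (Fintype.card ι - #A) := by
  have h1 : ∏ i ∈ K, (if i ∈ K then a else if i ∈ A then b else c) = a ^ #K := by
    rw [← prod_const]
    exact prod_congr rfl fun i hi => by simp [hi]
  have h2 : ∏ i ∈ A \ K, (if i ∈ K then a else if i ∈ A then b else c) = b ^ (#A - #K) := by
    rw [← card_sdiff_of_subset hK, ← prod_const]
    exact prod_congr rfl fun i hi => by
      obtain ⟨h, h'⟩ := mem_sdiff.1 hi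
      simp [h, h']
  have h3 : ∏ i ∈ Aᶜ, (if i ∈ K then a else if i ∈ A then b else c) =
      c ^ (Fintype.card ι - #A) := by
    rw [← card_compl, ← prod_const]
    exact prod_congr rfl fun i hi => by
      have h := mem_compl.1 hi
      have h' : i ∉ K := fun h' => h (hK h')
      simp [h, h']
  rw [← prod_mul_prod_compl A, ← prod_sdiff hK, h1, h2, h3, mul_comm (b ^ _)]

section Expectation

variable {Z : Type*} [MeasurableSpace Z]

open Finset in
open scoped Classical in
/-- The expected normalised likelihood ratio of the numbers of sample points in two disjoint sets
`U` and `V`, for an i.i.d. sample. -/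
lemma lintegral_scaledRatio_le (D : Measure Z) [IsProbabilityMeasure D] {U V : Set Z}
    (hU : MeasurableSet U) (hV : MeasurableSet V) (hUV : Disjoint U V) {α u v : ℝ≥0∞}
    (hDU : D U = α * u) (hDV : D V = α * v) (huv : u + v = 1) (m : ℕ) :
    ∫⁻ S, scaledRatio #{i | S i ∈ U} #{i | S i ∈ V} u v ∂(Measure.pi fun _ : Fin m => D) ≤ 4 := by
  set N : Set Z := (U ∪ V)ᶜ with hN
  have hNm : MeasurableSet N := (hU.union hV).compl
  have hα : α + D N = 1 := by
    have h := measure_add_measure_compl (μ := D) (hU.union hV)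
    rwa [measure_union hUV hV, hDU, hDV, ← mul_add, huv, mul_one, measure_univ] at h
  -- Samples whose points in `U ∪ V` have index set `A` and whose points in `U` have index set `K ⊆
  -- A`. The two counts are constant on each box.
  let box (A K : Finset (Fin m)) : Set (Fin m → Z) :=
    Set.pi Set.univ fun i => if i ∈ K then U else if i ∈ A then V else N
  have hbox A K : MeasurableSet (box A K) := by
    refine MeasurableSet.univ_pi fun i => ?_
    split_ifs <;> assumption
  have hpt (S : Fin m → Z) : scaledRatio #{i | S i ∈ U} #{i | S i ∈ V} u v ≤
      ∑ A : Finset (Fin m), ∑ K ∈ A.powerset,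
        (box A K).indicator (fun _ => scaledRatio #K (#A - #K) u v) S := by
    set K₀ : Finset (Fin m) := {i | S i ∈ U} with hK₀
    set J₀ : Finset (Fin m) := {i | S i ∈ V} with hJ₀
    have hdisj : Disjoint K₀ J₀ := disjoint_left.2 fun i hi hj =>
      Set.disjoint_left.1 hUV (mem_filter.1 hi).2 (mem_filter.1 hj).2
    have hcard : #(K₀ ∪ J₀) - #K₀ = #J₀ := by
      rw [card_union_of_disjoint hdisj]; omega
    have hmem : S ∈ box (K₀ ∪ J₀) K₀ := by
      intro i _
      by_cases h1 : S i ∈ U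
      · simp [hK₀, h1]
      by_cases h2 : S i ∈ V
      · simp [hK₀, hJ₀, h1, h2]
      · simp [hK₀, hJ₀, h1, h2, hN]
    calc scaledRatio #K₀ #J₀ u v
        = (box (K₀ ∪ J₀) K₀).indicator (fun _ => scaledRatio #K₀ (#(K₀ ∪ J₀) - #K₀) u v) S := by
          rw [Set.indicator_of_mem hmem, hcard]
      _ ≤ ∑ K ∈ (K₀ ∪ J₀).powerset,
            (box (K₀ ∪ J₀) K).indicator (fun _ => scaledRatio #K (#(K₀ ∪ J₀) - #K) u v) S :=
          single_le_sum (f := fun K =>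
            (box (K₀ ∪ J₀) K).indicator (fun _ => scaledRatio #K (#(K₀ ∪ J₀) - #K) u v) S)
            (fun _ _ => zero_le) (mem_powerset.2 subset_union_left)
      _ ≤ _ := single_le_sum (f := fun A : Finset (Fin m) => ∑ K ∈ A.powerset,
            (box A K).indicator (fun _ => scaledRatio #K (#A - #K) u v) S)
            (fun _ _ => zero_le) (mem_univ _)
  have hmeas A K : Measurable ((box A K).indicator fun _ => scaledRatio #K (#A - #K) u v) :=
    measurable_const.indicator (hbox A K)
  refine (lintegral_mono hpt).trans ?_
  rw [lintegral_finsetSum _ fun A _ => Finset.measurable_sum _ fun K _ => hmeas A K]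
  have hA (A : Finset (Fin m)) : ∫⁻ S, ∑ K ∈ A.powerset,
      (box A K).indicator (fun _ => scaledRatio #K (#A - #K) u v) S ∂(Measure.pi fun _ => D) ≤
        4 * (α ^ #A * D N ^ (m - #A)) := by
    rw [lintegral_finsetSum _ fun K _ => hmeas A K]
    calc _ ≤ ∑ K ∈ A.powerset, (if #A = 0 then 0 else
            ENNReal.ofReal (bernoulliMax #K (#A - #K) / √(#A : ℝ))) *
              (α ^ #A * D N ^ (m - #A)) := by
          refine sum_le_sum fun K hK => ?_
          rw [mem_powerset] at hK
          have hle := card_le_card hK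
          have hsplit : #K + (#A - #K) = #A := by omega
          rw [lintegral_indicator_const (hbox A K), Measure.pi_pi]
          simp only [apply_ite D, prod_ite_ite_mem hK, Fintype.card_fin, scaledRatio, hsplit]
          split_ifs with h0
          · simp
          rw [hDU, hDV, mul_pow, mul_pow, mul_mul_mul_comm, ← pow_add, hsplit,
            mul_comm (α ^ #A), mul_assoc, ← mul_assoc]
          gcongr
          -- The likelihood cancels only up to `≤`: if `u ^ k * v ^ j = 0`, the ratio is infinite
          -- but the box is null.
          exact ENNReal.mul_le_of_le_div le_rfl
      _ ≤ _ := by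
          rw [← sum_mul]
          gcongr
          exact sum_powerset_bernoulliMax_div_le A
  refine (sum_le_sum fun A _ => hA A).trans ?_
  -- Summing over `A` averages over the random group size: the weights sum to `(α + D N) ^ m = 1`.
  rw [← mul_sum, Fin.sum_pow_mul_eq_add_pow, hα, one_pow, mul_one]

end Expectation

/-! ### From the Gibbs risk to the risk of one classifier. -/

variable {𝒳 𝒴 𝒴' : Type*}

section Deterministic

variable [MeasurableSpace 𝒳] [MeasurableSpace 𝒴]

lemma measurableSet_attr_eq (g : Attr) :
    MeasurableSet {z : 𝒳 × Attr × 𝒴 | z.2.1 = g} :=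
  measurable_snd.fst (measurableSet_singleton g : MeasurableSet ({g} : Set Attr))

lemma measurable_forget_attr :
    Measurable (fun z : 𝒳 × Attr × 𝒴 => (z.1, z.2.2)) := by fun_prop

lemma isProbabilityMeasure_condDist (D : Measure (𝒳 × Attr × 𝒴)) [IsProbabilityMeasure D]
    {g : Attr} (hg : D {z | z.2.1 = g} ≠ 0) : IsProbabilityMeasure (condDist D g) := by
  have := ProbabilityTheory.cond_isProbabilityMeasure hg
  exact Measure.isProbabilityMeasure_map measurable_forget_attr.aemeasurable

lemma measure_attr_mul_condDist (D : Measure (𝒳 × Attr × 𝒴)) [IsProbabilityMeasure D]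
    {g : Attr} (hg : D {z | z.2.1 = g} ≠ 0) {B : Set (𝒳 × 𝒴)} (hB : MeasurableSet B) :
    D {z | z.2.1 = g ∧ (z.1, z.2.2) ∈ B} = D {z | z.2.1 = g} * condDist D g B := by
  rw [condDist, Measure.map_apply measurable_forget_attr hB,
    ProbabilityTheory.cond_apply (measurableSet_attr_eq g), ← mul_assoc,
    ENNReal.mul_inv_cancel hg (measure_ne_top _ _), one_mul]
  rfl

/-- Null `A` is included, both sides then being zero; the classifier may be almost surely right or
almost surely wrong. -/
lemma setIntegral_eq_measureReal_mul_cond {Z : Type*} [MeasurableSpace Z] (P : Measure Z)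
    [IsFiniteMeasure P] (A : Set Z) (f : Z → ℝ) :
    ∫ z in A, f z ∂P = P.real A * ∫ z, f z ∂(ProbabilityTheory.cond P A) := by
  rcases eq_or_ne (P A) 0 with h | h
  · simp [Measure.restrict_eq_zero.2 h, measureReal_def, h]
  · have h' : P.real A ≠ 0 := (ENNReal.toReal_pos h (measure_ne_top _ _)).ne'
    rw [ProbabilityTheory.cond, integral_smul_measure, ENNReal.toReal_inv, smul_eq_mul,
      ← measureReal_def, mul_inv_cancel_left₀ h']

variable {ℓ : 𝒴' → 𝒴 → ℝ} (hℓ : ∀ u y, ℓ u y = 0 ∨ ℓ u y = 1)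
  {ℋ : Set (𝒳 → 𝒴')} [MeasurableSpace ℋ]
  (hmeas : Measurable (fun p : ℋ × 𝒳 × 𝒴 => ℓ (p.1.1 p.2.1) p.2.2))

include hmeas in
lemma measurable_loss (h : ℋ) : Measurable fun z : 𝒳 × 𝒴 => ℓ (h.1 z.1) z.2 :=
  hmeas.comp measurable_prodMk_left

include hmeas in
lemma measurableSet_loss_eq (h : ℋ) (r : ℝ) :
    MeasurableSet {z : 𝒳 × 𝒴 | ℓ (h.1 z.1) z.2 = r} :=
  measurable_loss hmeas h (measurableSet_singleton r)

include hℓ hmeas in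
lemma risk_eq_measureReal (P : Measure (𝒳 × 𝒴)) (h : ℋ) :
    risk ℓ P h.1 = P.real {z | ℓ (h.1 z.1) z.2 = 1} := by
  rw [risk, ← integral_indicator_one (measurableSet_loss_eq hmeas h 1)]
  refine integral_congr_ae (.of_forall fun z => ?_)
  rcases hℓ (h.1 z.1) z.2 with h0 | h0 <;> simp [Set.indicator, h0]

include hℓ hmeas in
lemma measure_err_add_measure_ok (P : Measure (𝒳 × 𝒴)) [IsProbabilityMeasure P] (h : ℋ) :
    P {z | ℓ (h.1 z.1) z.2 = 1} + P {z | ℓ (h.1 z.1) z.2 = 0} = 1 := by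
  have e : {z : 𝒳 × 𝒴 | ℓ (h.1 z.1) z.2 = 0} = {z | ℓ (h.1 z.1) z.2 = 1}ᶜ := by
    ext z
    rcases hℓ (h.1 z.1) z.2 with h0 | h0 <;> simp [h0]
  rw [e, measure_add_measure_compl (measurableSet_loss_eq hmeas h 1), measure_univ]

include hℓ hmeas in
/-- The Gibbs risk splits over the examples on which a fixed classifier is right or wrong. -/
lemma integral_risk_eq (P : Measure (𝒳 × 𝒴)) [IsProbabilityMeasure P] (ρ : Measure ℋ)
    [IsProbabilityMeasure ρ] (h : ℋ) :
    ∫ h' : ℋ, risk ℓ P h'.1 ∂ρ =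
      (1 - risk ℓ P h.1) * bTerm ℓ P ρ h.1 + risk ℓ P h.1 * cTerm ℓ P ρ h.1 := by
  have hint : Integrable (fun p : ℋ × 𝒳 × 𝒴 => ℓ (p.1.1 p.2.1) p.2.2) (ρ.prod P) :=
    Integrable.of_bound hmeas.aestronglyMeasurable 1 (.of_forall fun p => by
      rcases hℓ (p.1.1 p.2.1) p.2.2 with h0 | h0 <;> simp [h0])
  have hU := measurableSet_loss_eq hmeas h 1
  have e : {z : 𝒳 × 𝒴 | ℓ (h.1 z.1) z.2 = 1}ᶜ = {z | ℓ (h.1 z.1) z.2 = 0} := by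
    ext z
    rcases hℓ (h.1 z.1) z.2 with h0 | h0 <;> simp [h0]
  have hr := risk_eq_measureReal hℓ hmeas P h
  have hr' : P.real {z | ℓ (h.1 z.1) z.2 = 0} = 1 - risk ℓ P h.1 := by
    rw [hr, ← e, probReal_compl_eq_one_sub hU]
  simp only [risk] at *
  rw [integral_integral_swap hint, ← integral_add_compl hU hint.integral_prod_right, e,
    setIntegral_eq_measureReal_mul_cond, setIntegral_eq_measureReal_mul_cond, hr', hr, bTerm, cTerm,
    condGibbs, condGibbs]
  ring

lemma risk_mem_Icc (P : Measure (𝒳 × 𝒴)) [IsProbabilityMeasure P]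
    (hℓ : ∀ u y, ℓ u y = 0 ∨ ℓ u y = 1)
    (hmeas : Measurable (fun p : ℋ × 𝒳 × 𝒴 => ℓ (p.1.1 p.2.1) p.2.2)) (h : ℋ) :
    risk ℓ P h.1 ∈ Set.Icc (0 : ℝ) 1 := by
  rw [risk_eq_measureReal hℓ hmeas]
  exact ⟨measureReal_nonneg, measureReal_le_one⟩

include hℓ hmeas in
/-- Bounds on a Gibbs risk and on the conditional Gibbs risks bound the risk of a classifier. -/
lemma risk_mem_of_valid (P : Measure (𝒳 × 𝒴)) [IsProbabilityMeasure P] (ρ : Measure ℋ)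
    [IsProbabilityMeasure ρ] (h : ℋ) {B : CondBounds} (hB : B.Valid ℓ P ρ h.1) {lo up : ℝ}
    (hlo : lo ≤ ∫ h' : ℋ, risk ℓ P h'.1 ∂ρ) (hup : ∫ h' : ℋ, risk ℓ P h'.1 ∂ρ ≤ up) :
    (lo - B.bUp) / (B.cUp - B.bUp) ≤ risk ℓ P h.1 ∧
      risk ℓ P h.1 ≤ (up - B.bLo) / (B.cLo - B.bLo) := by
  obtain ⟨hb, hc, hlt, hlt'⟩ := hB
  obtain ⟨hR0, hR1⟩ := risk_mem_Icc P hℓ hmeas h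
  have hsum := measure_err_add_measure_ok hℓ hmeas P h
  rw [integral_risk_eq hℓ hmeas P ρ h] at hlo hup
  have hR := risk_eq_measureReal hℓ hmeas P h
  set R := risk ℓ P h.1
  have hb' : (1 - R) * B.bLo ≤ (1 - R) * bTerm ℓ P ρ h.1 ∧
      (1 - R) * bTerm ℓ P ρ h.1 ≤ (1 - R) * B.bUp := by
    -- When the conditioning event is null its bounds are unavailable, but its weight is zero.
    by_cases h0 : P {z | ℓ (h.1 z.1) z.2 = 0} = 0
    · rw [h0, add_zero] at hsum
      have : R = 1 := by rw [hR, measureReal_def, hsum, ENNReal.toReal_one]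
      simp [this]
    · exact ⟨mul_le_mul_of_nonneg_left (hb h0).1 (by linarith),
        mul_le_mul_of_nonneg_left (hb h0).2 (by linarith)⟩
  have hc' : R * B.cLo ≤ R * cTerm ℓ P ρ h.1 ∧ R * cTerm ℓ P ρ h.1 ≤ R * B.cUp := by
    by_cases h0 : P {z | ℓ (h.1 z.1) z.2 = 1} = 0
    · have : R = 0 := by rw [hR, measureReal_def, h0, ENNReal.toReal_zero]
      simp [this]
    · exact ⟨mul_le_mul_of_nonneg_left (hc h0).1 hR0, mul_le_mul_of_nonneg_left (hc h0).2 hR0⟩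
  rw [div_le_iff₀ (by linarith), le_div_iff₀ (by linarith)]
  constructor <;> linarith

end Deterministic

lemma klLower_le {q r : ℝ} {ε : ℝ≥0∞} (hr : r ∈ Set.Icc (0 : ℝ) 1) (h : binKl q r ≤ ε) :
    klLower q ε ≤ r :=
  csInf_le ⟨0, fun _ hx => hx.1.1⟩ ⟨hr, h⟩

lemma le_klUpper {q r : ℝ} {ε : ℝ≥0∞} (hr : r ∈ Set.Icc (0 : ℝ) 1) (h : binKl q r ≤ ε) :
    r ≤ klUpper q ε :=
  le_csSup ⟨1, fun _ hx => hx.1.2⟩ ⟨hr, h⟩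

/-! ### Group subsamples and the PAC-Bayes event. -/

section Sample

variable {m : ℕ}

open scoped Classical in
/-- The number of examples of group `g` in the sample `S` on which `h` has loss `r`. -/
noncomputable def lossCount (ℓ : 𝒴' → 𝒴 → ℝ) (g : Attr) (r : ℝ) (S : Fin m → 𝒳 × Attr × 𝒴)
    (h : 𝒳 → 𝒴') : ℕ :=
  Finset.card {i | S i ∈ {z | z.2.1 = g ∧ (z.1, z.2.2) ∈ {z : 𝒳 × 𝒴 | ℓ (h z.1) z.2 = r}}}

lemma lossCount_one_add_lossCount_zero {ℓ : 𝒴' → 𝒴 → ℝ} (hℓ : ∀ u y, ℓ u y = 0 ∨ ℓ u y = 1)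
    (g : Attr) (S : Fin m → 𝒳 × Attr × 𝒴) (h : 𝒳 → 𝒴') :
    lossCount ℓ g 1 S h + lossCount ℓ g 0 S h = Fintype.card {i : Fin m // (S i).2.1 = g} := by
  classical
  rw [Fintype.card_subtype, lossCount, lossCount, ← Finset.card_union_of_disjoint]
  · congr 1
    ext i
    rcases hℓ (h (S i).1) (S i).2.2 with h0 | h0 <;> simp [h0]
  · refine Finset.disjoint_left.2 fun i hi hj => ?_
    have h1 := (Finset.mem_filter.1 hi).2.2
    have h2 := (Finset.mem_filter.1 hj).2.2
    exact one_ne_zero (h1.symm.trans h2)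

lemma empRisk_subsample {ℓ : 𝒴' → 𝒴 → ℝ} (hℓ : ∀ u y, ℓ u y = 0 ∨ ℓ u y = 1)
    (g : Attr) (S : Fin m → 𝒳 × Attr × 𝒴) (h : 𝒳 → 𝒴') :
    empRisk ℓ (subsample S g) h =
      (lossCount ℓ g 1 S h : ℝ) / Fintype.card {i : Fin m // (S i).2.1 = g} := by
  classical
  rw [empRisk, lossCount, Finset.card_filter, Nat.cast_sum]
  congr 1
  simp only [subsample]
  rw [← Finset.sum_subtype (s := Finset.univ.filter fun i => (S i).2.1 = g)
    (p := fun i => (S i).2.1 = g) (by simp) (fun i => ℓ (h (S i).1) (S i).2.2), Finset.sum_filter]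
  · refine Finset.sum_congr rfl fun i _ => ?_
    rcases hℓ (h (S i).1) (S i).2.2 with h0 | h0 <;> simp [h0]

variable [MeasurableSpace 𝒳] [MeasurableSpace 𝒴] {ℓ : 𝒴' → 𝒴 → ℝ}
  {ℋ : Set (𝒳 → 𝒴')} [MeasurableSpace ℋ]

lemma measurable_lossCount
    (hmeas : Measurable (fun p : ℋ × 𝒳 × 𝒴 => ℓ (p.1.1 p.2.1) p.2.2)) (g : Attr) (r : ℝ) :
    Measurable fun p : (Fin m → 𝒳 × Attr × 𝒴) × ℋ => lossCount ℓ g r p.1 p.2.1 := by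
  classical
  simp only [lossCount, Finset.card_filter]
  refine Finset.measurable_sum _ fun i _ => Measurable.ite ?_ measurable_const measurable_const
  have h1 : Measurable fun p : (Fin m → 𝒳 × Attr × 𝒴) × ℋ => p.1 i :=
    (measurable_pi_apply i).comp measurable_fst
  have h2 : Measurable fun p : (Fin m → 𝒳 × Attr × 𝒴) × ℋ => (p.2, (p.1 i).1, (p.1 i).2.2) :=
    measurable_snd.prodMk (measurable_forget_attr.comp h1)
  exact (h1 (measurableSet_attr_eq g)).inter ((hmeas.comp h2) (measurableSet_singleton r))

lemma measurable_scaledRatio {Ω : Type*} [MeasurableSpace Ω] {k j : Ω → ℕ} {u v : Ω → ℝ≥0∞}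
    (hk : Measurable k) (hj : Measurable j) (hu : Measurable u) (hv : Measurable v) :
    Measurable fun x => scaledRatio (k x) (j x) (u x) (v x) := by
  have h : Measurable fun p : (ℕ × ℕ) × ℝ≥0∞ × ℝ≥0∞ => scaledRatio p.1.1 p.1.2 p.2.1 p.2.2 := by
    refine measurable_from_prod_countable_right fun p => ?_
    by_cases hp : p.1 + p.2 = 0
    · simp only [scaledRatio, hp, if_true]
      exact measurable_const
    · simp only [scaledRatio, hp, if_false]
      fun_prop
  exact h.comp ((hk.prodMk hj).prodMk (hu.prodMk hv))

/-- The normalised likelihood ratio of the part of the sample in group `g`, averaged over `π`. -/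
noncomputable def avgScaledRatio (ℓ : 𝒴' → 𝒴 → ℝ) (D : Measure (𝒳 × Attr × 𝒴)) (π : Measure ℋ)
    (g : Attr) (S : Fin m → 𝒳 × Attr × 𝒴) : ℝ≥0∞ :=
  ∫⁻ h : ℋ, scaledRatio (lossCount ℓ g 1 S h.1) (lossCount ℓ g 0 S h.1)
    (condDist D g {z | ℓ (h.1 z.1) z.2 = 1}) (condDist D g {z | ℓ (h.1 z.1) z.2 = 0}) ∂π

variable (hℓ : ∀ u y, ℓ u y = 0 ∨ ℓ u y = 1)
  (hmeas : Measurable (fun p : ℋ × 𝒳 × 𝒴 => ℓ (p.1.1 p.2.1) p.2.2))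
  (D : Measure (𝒳 × Attr × 𝒴)) [IsProbabilityMeasure D] {g : Attr} (hg : D {z | z.2.1 = g} ≠ 0)

include hmeas in
lemma measurable_measure_loss_eq (P : Measure (𝒳 × 𝒴)) [IsProbabilityMeasure P] (r : ℝ) :
    Measurable fun h : ℋ => P {z | ℓ (h.1 z.1) z.2 = r} :=
  measurable_measure_prodMk_left (hmeas (measurableSet_singleton r))

include hmeas hg in
lemma measurable_scaledRatio_lossCount :
    Measurable fun p : (Fin m → 𝒳 × Attr × 𝒴) × ℋ =>
      scaledRatio (lossCount ℓ g 1 p.1 p.2.1) (lossCount ℓ g 0 p.1 p.2.1)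
        (condDist D g {z | ℓ (p.2.1 z.1) z.2 = 1}) (condDist D g {z | ℓ (p.2.1 z.1) z.2 = 0}) := by
  have := isProbabilityMeasure_condDist D hg
  exact measurable_scaledRatio (measurable_lossCount hmeas g 1) (measurable_lossCount hmeas g 0)
    ((measurable_measure_loss_eq hmeas (condDist D g) 1).comp measurable_snd)
    ((measurable_measure_loss_eq hmeas (condDist D g) 0).comp measurable_snd)

variable (π : Measure ℋ) [IsProbabilityMeasure π]

include hmeas hg in
lemma measurable_avgScaledRatio :
    Measurable fun S : Fin m → 𝒳 × Attr × 𝒴 => avgScaledRatio ℓ D π g S :=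
  (measurable_scaledRatio_lossCount hmeas D hg).lintegral_prod_right'

include hℓ hmeas hg in
lemma lintegral_avgScaledRatio_le :
    ∫⁻ S, avgScaledRatio ℓ D π g S ∂(Measure.pi fun _ : Fin m => D) ≤ 4 := by
  have := isProbabilityMeasure_condDist D hg
  unfold avgScaledRatio
  -- The prior does not depend on the sample, so the expectation can be taken for each fixed `h`.
  rw [lintegral_lintegral_swap (measurable_scaledRatio_lossCount hmeas D hg).aemeasurable]
  refine (lintegral_mono (g := fun _ => 4) fun h => ?_).trans (by simp)
  have hm (r : ℝ) : MeasurableSet {z : 𝒳 × Attr × 𝒴 | z.2.1 = g ∧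
      (z.1, z.2.2) ∈ {z : 𝒳 × 𝒴 | ℓ (h.1 z.1) z.2 = r}} := (measurableSet_attr_eq g).inter
    (measurable_forget_attr (measurableSet_loss_eq hmeas h r))
  have hdisj : Disjoint
      {z : 𝒳 × Attr × 𝒴 | z.2.1 = g ∧ (z.1, z.2.2) ∈ {z : 𝒳 × 𝒴 | ℓ (h.1 z.1) z.2 = 1}}
      {z : 𝒳 × Attr × 𝒴 | z.2.1 = g ∧ (z.1, z.2.2) ∈ {z : 𝒳 × 𝒴 | ℓ (h.1 z.1) z.2 = 0}} :=
    Set.disjoint_left.2 fun z h1 h2 =>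
      one_ne_zero ((show ℓ (h.1 z.1) z.2.2 = 1 from h1.2).symm.trans h2.2)
  have key := lintegral_scaledRatio_le D (hm 1) (hm 0) hdisj
    (measure_attr_mul_condDist D hg (measurableSet_loss_eq hmeas h 1))
    (measure_attr_mul_condDist D hg (measurableSet_loss_eq hmeas h 0))
    (measure_err_add_measure_ok hℓ hmeas (condDist D g) h) m
  unfold lossCount
  convert key

include hℓ hmeas hg in
/-- The Seeger-Maurer bounds hold for all posteriors where the averaged ratio is small. -/
lemma integral_risk_mem_of_avgScaledRatio_le {δ : ℝ} (hδ : δ ∈ Set.Ioc (0 : ℝ) 1)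
    {S : Fin m → 𝒳 × Attr × 𝒴} (hS : avgScaledRatio ℓ D π g S ≤ ENNReal.ofReal (8 / δ))
    (ρ : Measure ℋ) [IsProbabilityMeasure ρ] :
    gibbsLower ℓ (subsample S g) ρ π (δ / 4) ≤ ∫ h : ℋ, risk ℓ (condDist D g) h.1 ∂ρ ∧
      ∫ h : ℋ, risk ℓ (condDist D g) h.1 ∂ρ ≤ gibbsUpper ℓ (subsample S g) ρ π (δ / 4) := by
  have := isProbabilityMeasure_condDist D hg
  obtain ⟨hδ0, hδ1⟩ := hδ
  have hum := measurable_measure_loss_eq hmeas (condDist D g) 1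
  have hr : (fun h : ℋ => risk ℓ (condDist D g) h.1) =
      fun h : ℋ => (condDist D g {z | ℓ (h.1 z.1) z.2 = 1}).toReal :=
    funext fun h => risk_eq_measureReal hℓ hmeas (condDist D g) h
  have hmem : ∫ h : ℋ, risk ℓ (condDist D g) h.1 ∂ρ ∈ Set.Icc (0 : ℝ) 1 := by
    have h01 (h : ℋ) := risk_mem_Icc (condDist D g) hℓ hmeas h
    refine ⟨integral_nonneg fun h => (h01 h).1, ?_⟩
    calc _ ≤ ∫ _, (1 : ℝ) ∂ρ := integral_mono_of_nonneg (.of_forall fun h => (h01 h).1)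
          (integrable_const _) (.of_forall fun h => (h01 h).2)
      _ = 1 := by simp
  set n := Fintype.card {i : Fin m // (S i).2.1 = g} with hn
  suffices hkl : binKl (empGibbs ℓ (subsample S g) ρ) (∫ h : ℋ, risk ℓ (condDist D g) h.1 ∂ρ) ≤
      complexity n ρ π (δ / 4) from ⟨klLower_le hmem hkl, le_klUpper hmem hkl⟩
  -- Without data from the group the complexity is `⊤` and nothing is claimed.
  rcases eq_or_ne n 0 with h0 | h0
  · simp [complexity, h0]
  have hcount (h : ℋ) : lossCount ℓ g 1 S h.1 + lossCount ℓ g 0 S h.1 = n :=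
    lossCount_one_add_lossCount_zero hℓ g S h.1
  have hs : 1 ≤ √(n : ℝ) := by
    rw [Real.one_le_sqrt]; exact_mod_cast Nat.one_le_iff_ne_zero.2 h0
  rw [complexity, if_neg h0, empGibbs, hr]
  simp only [empRisk_subsample hℓ, ← hn]
  refine binKl_integral_le h0 ((measurable_lossCount hmeas g 1).comp measurable_prodMk_left) hcount
    hum (measure_err_add_measure_ok hℓ hmeas (condDist D g)) ?_ ?_
  · rw [le_div_iff₀ (by positivity)]
    linarith
  · calc _ = ∫⁻ h : ℋ, ENNReal.ofReal √(n : ℝ) * scaledRatio (lossCount ℓ g 1 S h.1)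
            (lossCount ℓ g 0 S h.1) (condDist D g {z | ℓ (h.1 z.1) z.2 = 1})
            (condDist D g {z | ℓ (h.1 z.1) z.2 = 0}) ∂π := by
          refine lintegral_congr fun h => ?_
          rw [scaledRatio, hcount, if_neg h0, ← mul_div_assoc, ← ENNReal.ofReal_mul (by positivity),
            mul_div_cancel₀ _ (by positivity)]
          rfl
      -- The threshold `8 / δ` is chosen so that `√n * (8 / δ) = 2 * √n / (δ / 4)`.
      _ ≤ ENNReal.ofReal √(n : ℝ) * ENNReal.ofReal (8 / δ) := by
          rw [lintegral_const_mul' _ _ ENNReal.ofReal_ne_top]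
          exact mul_le_mul_right hS _
      _ = _ := by
          rw [← ENNReal.ofReal_mul (by positivity)]
          congr 1
          field_simp
          ring

end Sample

end FairPACBayes

/-! ### The confidence event and the fairness bound. -/

theorem mainTheorem1 {𝒳 𝒴 𝒴' : Type*} [MeasurableSpace 𝒳] [MeasurableSpace 𝒴]
    (D : Measure (𝒳 × Attr × 𝒴)) [IsProbabilityMeasure D]
    (hD : ∀ g : Attr, D {z | z.2.1 = g} ≠ 0)
    (ℓ : 𝒴' → 𝒴 → ℝ) (hℓ : ∀ u y, ℓ u y = 0 ∨ ℓ u y = 1)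
    (ℋ : Set (𝒳 → 𝒴')) [MeasurableSpace ℋ]
    (hmeas : Measurable (fun p : ℋ × 𝒳 × 𝒴 => ℓ (p.1.1 p.2.1) p.2.2))
    (π : Measure ℋ) [IsProbabilityMeasure π]
    (δ : ℝ) (hδ : δ ∈ Set.Ioc (0 : ℝ) 1) (m : ℕ) :
    ∃ E : Set (Fin m → 𝒳 × Attr × 𝒴), MeasurableSet E ∧
      ENNReal.ofReal (1 - δ) ≤ Measure.pi (fun _ : Fin m => D) E ∧
      ∀ S ∈ E, ∀ ρ : Measure ℋ, IsProbabilityMeasure ρ → ∀ h ∈ ℋ,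
        ∀ B : Attr → CondBounds, (∀ g : Attr, (B g).Valid ℓ (condDist D g) ρ h) →
          fairRisk ℓ D h ≤ max
            (detUpper ℓ (subsample S Attr.a) ρ π (δ / 4) (B Attr.a)
              - detLower ℓ (subsample S Attr.b) ρ π (δ / 4) (B Attr.b))
            (detUpper ℓ (subsample S Attr.b) ρ π (δ / 4) (B Attr.b)
              - detLower ℓ (subsample S Attr.a) ρ π (δ / 4) (B Attr.a)) := by
  obtain ⟨hδ0, hδ1⟩ := id hδ
  set ν := Measure.pi fun _ : Fin m => D
  have hF g := measurable_avgScaledRatio (m := m) hmeas D (hD g) π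
  have hbad (g : Attr) :
      ν {S | avgScaledRatio ℓ D π g S ≤ ENNReal.ofReal (8 / δ)}ᶜ ≤ ENNReal.ofReal (δ / 2) := by
    have hpos : ENNReal.ofReal (8 / δ) ≠ 0 := by
      simpa using div_pos (by norm_num : (0 : ℝ) < 8) hδ0
    -- Markov's inequality with mean at most 4 and threshold `8 / δ`.
    calc _ ≤ ν {S | ENNReal.ofReal (8 / δ) ≤ avgScaledRatio ℓ D π g S} :=
          measure_mono fun S hS =>
            (not_le.1 (show ¬ avgScaledRatio ℓ D π g S ≤ ENNReal.ofReal (8 / δ) from hS)).le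
      _ ≤ (∫⁻ S, avgScaledRatio ℓ D π g S ∂ν) / ENNReal.ofReal (8 / δ) :=
          meas_ge_le_lintegral_div (hF g).aemeasurable hpos ENNReal.ofReal_ne_top
      _ ≤ ENNReal.ofReal 4 / ENNReal.ofReal (8 / δ) := by
          gcongr
          simpa using lintegral_avgScaledRatio_le hℓ hmeas D (hD g) π
      _ = ENNReal.ofReal (δ / 2) := by
          rw [← ENNReal.ofReal_div_of_pos (by positivity)]
          congr 1
          field_simp
          norm_num
  have hEm (g : Attr) : MeasurableSet {S | avgScaledRatio ℓ D π g S ≤ ENNReal.ofReal (8 / δ)} :=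
    hF g measurableSet_Iic
  refine ⟨{S | avgScaledRatio ℓ D π Attr.a S ≤ ENNReal.ofReal (8 / δ)} ∩
    {S | avgScaledRatio ℓ D π Attr.b S ≤ ENNReal.ofReal (8 / δ)}, (hEm _).inter (hEm _), ?_, ?_⟩
  · rw [ENNReal.ofReal_sub _ hδ0.le, ENNReal.ofReal_one, tsub_le_iff_right, ← measure_univ (μ := ν),
      ← measure_add_measure_compl ((hEm Attr.a).inter (hEm Attr.b)), Set.compl_inter]
    gcongr
    refine (measure_union_le _ _).trans ((add_le_add (hbad _) (hbad _)).trans (le_of_eq ?_))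
    rw [← ENNReal.ofReal_add (by positivity) (by positivity), add_halves]
  · rintro S ⟨ha, hb⟩ ρ hρ h hh B hB
    have hbound {g : Attr} (hS : avgScaledRatio ℓ D π g S ≤ ENNReal.ofReal (8 / δ)) :
        detLower ℓ (subsample S g) ρ π (δ / 4) (B g) ≤ risk ℓ (condDist D g) h ∧
          risk ℓ (condDist D g) h ≤ detUpper ℓ (subsample S g) ρ π (δ / 4) (B g) := by
      have := isProbabilityMeasure_condDist D (hD g)
      obtain ⟨hlo, hup⟩ := integral_risk_mem_of_avgScaledRatio_le hℓ hmeas D (hD g) π hδ hS ρ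
      exact risk_mem_of_valid hℓ hmeas (condDist D g) ρ ⟨h, hh⟩ (hB g) hlo hup
    obtain ⟨ha1, ha2⟩ := hbound ha
    obtain ⟨hb1, hb2⟩ := hbound hb
    rw [fairRisk, abs_eq_max_neg]
    exact max_le_max (by linarith) (by linarith)
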